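/- Let $\mathbb D$ be the open unit disc and $\mathbb T$ the unit circle. For $\xi\in\mathbb T$ let $$\Gamma_{1/2}(\xi)=\{z\in\mathbb D:|z|<1/2\}\cup\bigcup_{|z|<1/2}[z,\xi),$$ where $[z,\xi)=\{(1-s)z+s\xi : 0\le s<1\}$. For $1<p,q<\infty$, the analytic tent space $AT^q_p$ consists of all functions $f$ analytic in $\mathbb D$ with $$\|f\|_{AT^q_p}=\left\{\int_{\mathbb T}\left(\int_{\Gamma_{1/2}(\xi)}|f(z)|^p\,\frac{dA(z)}{1-|z|^2}\right)^{q/p}|d\xi|\right\}^{1/q}<\infty,$$ where $dA$ is the area measure normalized by $A(\mathbb D)=1$ and $|d\xi|$ is arc length. A positive Borel measure $\mu$ on $[0,1)$ is a $1$-Carleson measure if $\sup_{t\in[0,1)}\mu([t,1))/(1-t)<\infty$; its moments are $\mu_n=\int_{[0,1)}t^n\,d\mu(t)$, $n=0,1,2,\dots$ **Proposition.** Let $2<p<\infty$ and $1<q<\infty$ with $\frac1p+\frac1q<1$, let $f(z)=\sum_{k\ge0}a_kz^k\in AT^q_p$, and let $\mu$ be a $1$-Carleson measure on $[0,1)$.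 Then: (i) for every integer $n\ge0$, $\sum_{k\ge0}\mu_{n+k}|a_k|<\infty$; (ii) the power series $$\mathcal H_\mu(f)(z)=\sum_{n=0}^\infty\left(\sum_{k=0}^\infty\mu_{n+k}a_k\right)z^n$$ converges for every $z\in\mathbb D$ and represents an analytic function in $\mathbb D$; (iii) for every $z\in\mathbb D$, the function $t\mapsto\frac{f(t)}{1-tz}$ is $\mu$-integrable on $[0,1)$ and $$\mathcal H_\mu(f)(z)=\mathcal I_\mu(f)(z):=\int_{[0,1)}\frac{f(t)}{1-tz}\,d\mu(t).$$ -/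

import Mathlib

open MeasureTheory
open scoped ENNReal

noncomputable section

/-- The open unit disc `𝔻` of the complex plane. -/
def unitDisc : Set ℂ := Metric.ball 0 1

/-- The half-open segment `[z, ξ) = {(1 - s) z + s ξ : 0 ≤ s < 1}`. -/
def halfOpenSegment (z ξ : ℂ) : Set ℂ :=
  (fun s : ℝ => ((1 - s : ℝ) : ℂ) * z + (s : ℂ) * ξ) '' Set.Ico (0 : ℝ) 1

/-- The cone-like region
`Γ_{1/2}(ξ) = {z ∈ 𝔻 : |z| < 1/2} ∪ ⋃_{|z| < 1/2} [z, ξ)` with vertex `ξ ∈ 𝕋`. -/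
def tentRegion (ξ : ℂ) : Set ℂ :=
  Metric.ball (0 : ℂ) (1 / 2) ∪ ⋃ z ∈ Metric.ball (0 : ℂ) (1 / 2), halfOpenSegment z ξ

/-- The area measure `dA` of the plane, normalized so that the unit disc has area `1`. -/
def normalizedArea : Measure ℂ := (ENNReal.ofReal Real.pi)⁻¹ • (volume : Measure ℂ)

/-- The tent space norm, with values in `[0, ∞]`:
`{∫_𝕋 (∫_{Γ_{1/2}(ξ)} |f(z)|^p dA(z) / (1 - |z|²))^{q/p} |dξ|}^{1/q}`,
the circle being parametrized by arc length, `ξ = e^{iθ}` with `0 < θ ≤ 2π`. -/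
def tentNorm (p q : ℝ) (f : ℂ → ℂ) : ℝ≥0∞ :=
  (∫⁻ θ in Set.Ioc (0 : ℝ) (2 * Real.pi),
    (∫⁻ z in tentRegion (Complex.exp (θ * Complex.I)),
      ENNReal.ofReal (‖f z‖ ^ p / (1 - ‖z‖ ^ 2)) ∂normalizedArea) ^ (q / p)) ^ (1 / q)

/-- Membership of `f` in the analytic tent space `AT^q_p`; only the restriction of `f` to the
unit disc matters. -/
structure MemAnalyticTent (p q : ℝ) (f : ℂ → ℂ) : Prop where
  analytic : AnalyticOnNhd ℂ f unitDisc
  norm_lt_top : tentNorm p q f < ∞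

/-- A positive Borel measure `μ` on `[0, 1)` is a 1-Carleson measure if
`sup_{t ∈ [0, 1)} μ([t, 1)) / (1 - t) < ∞`. Here `Set.Ici t`, formed inside the type `[0, 1)`,
is the interval `[t, 1)`. -/
def IsOneCarleson (μ : Measure (Set.Ico (0 : ℝ) 1)) : Prop :=
  (⨆ t : Set.Ico (0 : ℝ) 1, μ (Set.Ici t) / ENNReal.ofReal (1 - (t : ℝ))) < ∞

/-- The moments `μ_n = ∫ t^n dμ(t)` (a finite integral as soon as `μ` is a finite measure). -/
def moment (μ : Measure (Set.Ico (0 : ℝ) 1)) (n : ℕ) : ℝ := ∫ t, (t : ℝ) ^ n ∂μ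

/-- The `n`-th entry `∑_k μ_{n+k} a_k` of the Hankel matrix `(μ_{n+k})` applied to `a`. -/
def hankelCoeff (μ : Measure (Set.Ico (0 : ℝ) 1)) (a : ℕ → ℂ) (n : ℕ) : ℂ :=
  ∑' k, (moment μ (n + k) : ℂ) * a k

/-- The generalized Hilbert operator applied to `f(z) = ∑ a_k z^k`:
`H_μ(f)(z) = ∑_n (∑_k μ_{n+k} a_k) z^n`. -/
def generalizedHilbert (μ : Measure (Set.Ico (0 : ℝ) 1)) (a : ℕ → ℂ) (z : ℂ) : ℂ :=
  ∑' n, hankelCoeff μ a n * z ^ n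

/-- The integral operator `I_μ(f)(z) = ∫ f(t) / (1 - t z) dμ(t)`. -/
def integralHilbert (μ : Measure (Set.Ico (0 : ℝ) 1)) (f : ℂ → ℂ) (z : ℂ) : ℂ :=
  ∫ t, f ((t : ℝ) : ℂ) / (1 - ((t : ℝ) : ℂ) * z) ∂μ

end

/-!
Everything follows from the single estimate `∑ |a_k| / (k + 1) < ∞`. A 1-Carleson measure has
moments `μ_k = O(1 / (k + 1))` by the layer cake formula (`IsOneCarleson.exists_moment_le`), so the
estimate gives `∑ μ_k |a_k| < ∞`. The moments decrease, hence this one sum dominates every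
`∑_k μ_{n+k} |a_k|`; the coefficients of `H_μ(f)` are then bounded, and since `∑ μ_k |a_k|` is the
integral of `∑ |a_k| t^k`, sum and integral may be interchanged twice, once to see that the `n`-th
coefficient is `∫ t^n f(t) dμ(t)` and once to sum the geometric series in `tz`
(`generalizedHilbert_eq_integralHilbert`).

To bound the coefficients, let `G(θ)` be the inner area integral over the region `Γ(e^{iθ})`. The
disc of radius `δ = (1 - r) / 4` about `r e^{iφ}` lies in `Γ(e^{iθ})` as soon as `|φ - θ| < δ`, so
the sub-mean value property of `|f|^p` gives `|f(r e^{iφ})|^p δ ≤ 10 G(θ)`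
(`enorm_rpow_mul_le_tentAreaIntegral`). The circle has finite measure, so `q` may be replaced by
`s = min(q, 2)`. Raising to the power `s / p` and integrating in `θ`, with `φ = θ` respectively with
`φ` fixed, yields
`∫ |f(r e^{iθ})|^s dθ ≲ δ^{-s/p}` and `sup_φ |f(r e^{iφ})|^s ≲ δ^{-s/p-1}`.
As `s ≤ 2`, interpolation between the two gives `∫ |f(r e^{iθ})|² dθ ≲ (1 - r)^{-b}` with
`b = 2/p + 2/s - 1` (`MemAnalyticTent.exists_integral_sq_le`), and `b < 1` is exactly what `p > 2`
and `1/p + 1/q < 1` provide. By Parseval, the dyadic blocks `2^j ≤ k < 2^{j+1}` of `∑ |a_k|²` are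
`O(2^{jb})`, so by Cauchy–Schwarz those of `∑ |a_k| / (k + 1)` are `O(2^{j(b-1)/2})`, a convergent
geometric series (`summable_norm_div_of_sum_sq_le`).
-/

/-! ### The sub-mean value property -/

theorem enorm_center_mul_le_lintegral_circle {f : ℂ → ℂ} {w : ℂ} {r : ℝ} (hr : 0 ≤ r)
    (hf : DiffContOnCl ℂ f (Metric.ball w r)) :
    ‖f w‖ₑ * ENNReal.ofReal (2 * Real.pi) ≤
      ∫⁻ φ in Set.Ioo (-Real.pi) Real.pi, ‖f (circleMap w r φ)‖ₑ := by
  have hmv := DiffContOnCl.circleAverage (c := w) (R := r) (f := f) (by rwa [abs_of_nonneg hr])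
  have hpi := Real.two_pi_pos
  rw [Real.circleAverage_eq_integral_add (-Real.pi),
    intervalIntegral.integral_comp_add_right (fun φ => f (circleMap w r φ)),
    inv_smul_eq_iff₀ hpi.ne', intervalIntegral.integral_of_le (by linarith)] at hmv
  have h := enorm_integral_le_lintegral_enorm
    (μ := volume.restrict (Set.Ioc (0 + -Real.pi) (2 * Real.pi + -Real.pi)))
    (fun φ => f (circleMap w r φ))
  rw [hmv, enorm_smul, Real.enorm_eq_ofReal hpi.le, mul_comm] at h
  refine h.trans (le_of_eq ?_)
  rw [setLIntegral_congr Ioo_ae_eq_Ioc, show 0 + -Real.pi = -Real.pi by ring,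
    show 2 * Real.pi + -Real.pi = Real.pi by ring]

theorem enorm_center_mul_volume_le {f : ℂ → ℂ} {w : ℂ} {δ : ℝ}
    (hf : DifferentiableOn ℂ f (Metric.ball w δ)) :
    ‖f w‖ₑ * volume (Metric.ball w δ) ≤ ∫⁻ z in Metric.ball w δ, ‖f z‖ₑ := by
  have hmeas : Measurable ((Metric.ball w δ).indicator fun z => ‖f z‖ₑ) := by
    classical
    rw [← Set.piecewise_eq_indicator]
    exact hf.continuousOn.enorm.measurable_piecewise continuousOn_const
      Metric.isOpen_ball.measurableSet
  -- Polar coordinates centred at `w`, for functions supported in the disc.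
  have key : ∀ g : ℂ → ℝ≥0∞, Measurable ((Metric.ball w δ).indicator g) →
      ∫⁻ z in Metric.ball w δ, g z = ∫⁻ r in Set.Ioi (0 : ℝ), ∫⁻ φ in Set.Ioo (-Real.pi) Real.pi,
        ENNReal.ofReal r * (Metric.ball w δ).indicator g (circleMap w r φ) := by
    intro g hg
    rw [← lintegral_indicator Metric.isOpen_ball.measurableSet,
      ← lintegral_add_left_eq_self _ w, ← Complex.lintegral_comp_polarCoord_symm]
    have htarget : polarCoord.target = Set.Ioi (0 : ℝ) ×ˢ Set.Ioo (-Real.pi) Real.pi := rfl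
    rw [htarget, Measure.volume_eq_prod, ← Measure.prod_restrict, lintegral_prod]
    · refine lintegral_congr fun r => lintegral_congr fun φ => ?_
      rw [Complex.polarCoord_symm_apply, circleMap, Complex.exp_mul_I, smul_eq_mul]
      push_cast
      rfl
    · refine Measurable.aemeasurable ?_
      simp only [Complex.polarCoord_symm_apply, smul_eq_mul]
      refine Measurable.mul (by fun_prop) (hg.comp ?_)
      fun_prop
  rw [← setLIntegral_const, key _ (measurable_const.indicator Metric.isOpen_ball.measurableSet),
    key _ hmeas]
  refine setLIntegral_mono' measurableSet_Ioi fun r (hr : 0 < r) => ?_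
  have hmem : ∀ φ, circleMap w r φ ∈ Metric.ball w δ ↔ r < δ := by
    intro φ
    rw [Metric.mem_ball, dist_eq_norm, circleMap_sub_center, norm_circleMap_zero, abs_of_pos hr]
  by_cases hrδ : r < δ
  · rw [lintegral_const_mul' _ _ ENNReal.ofReal_ne_top, lintegral_const_mul' _ _ ENNReal.ofReal_ne_top]
    gcongr ENNReal.ofReal r * ?_
    simp_rw [Set.indicator_of_mem ((hmem _).2 hrδ)]
    rw [setLIntegral_const, Real.volume_Ioo, show Real.pi - -Real.pi = 2 * Real.pi by ring]
    refine enorm_center_mul_le_lintegral_circle hr.le ?_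
    exact (hf.mono (Metric.closedBall_subset_ball hrδ)).diffContOnCl_ball subset_rfl
  · simp [Set.indicator, hmem, hrδ]

/-- The sub-mean value property of `|f|^p` on discs: Hölder's inequality applied to the case
`p = 1`. -/
theorem enorm_rpow_center_mul_volume_le {f : ℂ → ℂ} {w : ℂ} {δ p : ℝ} (hp : 1 ≤ p) (hδ : 0 < δ)
    (hf : DifferentiableOn ℂ f (Metric.ball w δ)) :
    ‖f w‖ₑ ^ p * volume (Metric.ball w δ) ≤ ∫⁻ z in Metric.ball w δ, ‖f z‖ₑ ^ p := by
  have hp0 : 0 < p := by linarith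
  set V := volume (Metric.ball w δ)
  have hV0 : V ≠ 0 := (Metric.measure_ball_pos _ _ hδ).ne'
  have hVt : V ≠ ∞ := measure_ball_lt_top.ne
  have h1 := enorm_center_mul_volume_le hf
  have h2 := eLpNorm_le_eLpNorm_mul_rpow_measure_univ (μ := volume.restrict (Metric.ball w δ))
    (p := 1) (q := ENNReal.ofReal p) (f := f) (by simpa using hp)
    (hf.continuousOn.aestronglyMeasurable Metric.isOpen_ball.measurableSet)
  rw [eLpNorm_one_eq_lintegral_enorm, eLpNorm_eq_lintegral_rpow_enorm_toReal (by simpa using hp0)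
    (by simp), ENNReal.toReal_ofReal hp0.le, Measure.restrict_apply_univ] at h2
  have h3 := ENNReal.rpow_le_rpow (h1.trans h2) hp0.le
  rw [ENNReal.mul_rpow_of_nonneg _ _ hp0.le, ENNReal.mul_rpow_of_nonneg _ _ hp0.le,
    ← ENNReal.rpow_mul, ← ENNReal.rpow_mul, one_div_mul_cancel hp0.ne', ENNReal.rpow_one] at h3
  have h4 : (1 / (1 : ℝ≥0∞).toReal - 1 / p) * p = p - 1 := by
    simp; field_simp
  change _ * V ^ p ≤ _ * V ^ _ at h3
  rw [h4] at h3
  have hpow0 : V ^ (p - 1) ≠ 0 := (ENNReal.rpow_pos (pos_iff_ne_zero.2 hV0) hVt).ne'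
  have hpowt : V ^ (p - 1) ≠ ∞ := ENNReal.rpow_ne_top_of_nonneg (by linarith) hVt
  rw [show p = 1 + (p - 1) by ring, ENNReal.rpow_add _ _ hV0 hVt, ENNReal.rpow_one,
    show 1 + (p - 1) = p by ring, ← mul_assoc] at h3
  exact (ENNReal.mul_le_mul_iff_left hpow0 hpowt).1 h3

/-! ### Circular means of functions in analytic tent spaces -/

/-- `Γ(ξ)` contains the discs `|z - sξ| < (1 - s) / 2`, `0 ≤ s < 1`; a disc of half that radius about
a point at distance less than `(1 - r) / 4` from `r e^{iθ}` is inside the one with `s = r`. -/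
theorem ball_circleMap_subset_tentRegion {r θ φ : ℝ} (hr0 : 0 ≤ r) (hr1 : r < 1)
    (h : |φ - θ| < (1 - r) / 4) :
    Metric.ball (circleMap 0 r φ) ((1 - r) / 4) ⊆ tentRegion (Complex.exp (θ * Complex.I)) := by
  intro z hz
  rw [Metric.mem_ball] at hz
  have hlip : dist (circleMap 0 r φ) (circleMap 0 r θ) ≤ r * |φ - θ| := by
    have := (lipschitzWith_circleMap 0 r).dist_le_mul φ θ
    simpa [abs_of_nonneg hr0, Real.dist_eq] using this
  have hzr : ‖z - circleMap 0 r θ‖ < (1 - r) / 2 := by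
    rw [← dist_eq_norm]
    have h1 := dist_triangle z (circleMap 0 r φ) (circleMap 0 r θ)
    have h2 : r * |φ - θ| ≤ |φ - θ| := mul_le_of_le_one_left (abs_nonneg _) hr1.le
    linarith
  have hpos : 0 < 1 - r := by linarith
  have hne : ((1 - r : ℝ) : ℂ) ≠ 0 := by exact_mod_cast hpos.ne'
  refine Or.inr (Set.mem_iUnion₂.2 ⟨(z - circleMap 0 r θ) / ((1 - r : ℝ) : ℂ), ?_, r, ⟨hr0, hr1⟩, ?_⟩)
  · rw [mem_ball_zero_iff, norm_div, Complex.norm_real, Real.norm_of_nonneg hpos.le,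
      div_lt_iff₀ hpos]
    linarith
  · simp only
    rw [mul_div_cancel₀ _ hne]
    simp [circleMap]

/-- The area integral `∫_{Γ(ξ)} |f|^p dA / (1 - |z|²)` at `ξ = e^{iθ}`: the `p`-th power of the
area function whose `L^q` norm over the circle is the tent space norm. -/
noncomputable def tentAreaIntegral (p : ℝ) (f : ℂ → ℂ) (θ : ℝ) : ℝ≥0∞ :=
  ∫⁻ z in tentRegion (Complex.exp (θ * Complex.I)),
    ENNReal.ofReal (‖f z‖ ^ p / (1 - ‖z‖ ^ 2)) ∂normalizedArea

/-- Pointwise bound of `f` by the area integral at nearby boundary points. The constant `10` comes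
from `1 - |z|² ≤ 2 (1 - |z|) ≤ 10 δ` on the disc of radius `δ = (1 - r) / 4` about `r e^{iφ}`. -/
theorem enorm_rpow_mul_le_tentAreaIntegral {p r θ φ : ℝ} {f : ℂ → ℂ} (hp : 1 ≤ p)
    (hf : DifferentiableOn ℂ f unitDisc) (hr0 : 0 ≤ r) (hr1 : r < 1)
    (h : |φ - θ| < (1 - r) / 4) :
    ‖f (circleMap 0 r φ)‖ₑ ^ p * ENNReal.ofReal ((1 - r) / 4) ≤ 10 * tentAreaIntegral p f θ := by
  set δ := (1 - r) / 4 with hδ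
  set w := circleMap 0 r φ
  have hδ0 : 0 < δ := by rw [hδ]; linarith
  have hw : ‖w‖ = r := by simp [w, abs_of_nonneg hr0]
  have hball : ∀ z ∈ Metric.ball w δ, r - δ < ‖z‖ ∧ ‖z‖ < r + δ := by
    intro z hz
    rw [Metric.mem_ball, dist_eq_norm] at hz
    have h1 := norm_sub_norm_le w z
    have h2 := norm_sub_norm_le z w
    rw [norm_sub_rev] at h1
    constructor <;> linarith
  have hsub : Metric.ball w δ ⊆ unitDisc := fun z hz => by
    simpa [unitDisc] using (by linarith [(hball z hz).2] : ‖z‖ < 1)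
  have hsm := enorm_rpow_center_mul_volume_le hp hδ0 (hf.mono hsub)
  have hpi : ENNReal.ofReal Real.pi ≠ 0 := by simpa using Real.pi_pos
  have hpt : ∀ z ∈ Metric.ball w δ, ENNReal.ofReal (10 * δ)⁻¹ * ‖f z‖ₑ ^ p ≤
      ENNReal.ofReal (‖f z‖ ^ p / (1 - ‖z‖ ^ 2)) := by
    intro z hz
    obtain ⟨hz1, hz2⟩ := hball z hz
    rw [← ofReal_norm, ENNReal.ofReal_rpow_of_nonneg (norm_nonneg _) (by linarith),
      ← ENNReal.ofReal_mul (by positivity), mul_comm, ← div_eq_mul_inv]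
    refine ENNReal.ofReal_le_ofReal (div_le_div_of_nonneg_left (by positivity) ?_ ?_)
    · nlinarith [norm_nonneg z]
    · nlinarith [norm_nonneg z]
  have hG : (ENNReal.ofReal Real.pi)⁻¹ * (ENNReal.ofReal (10 * δ)⁻¹ *
      ∫⁻ z in Metric.ball w δ, ‖f z‖ₑ ^ p) ≤ tentAreaIntegral p f θ := by
    rw [tentAreaIntegral]
    refine le_trans ?_ (lintegral_mono_set (ball_circleMap_subset_tentRegion hr0 hr1 h))
    rw [normalizedArea, Measure.restrict_smul, lintegral_smul_measure, smul_eq_mul,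
      ← lintegral_const_mul' _ _ ENNReal.ofReal_ne_top]
    gcongr (ENNReal.ofReal Real.pi)⁻¹ * ?_
    exact setLIntegral_mono' Metric.isOpen_ball.measurableSet hpt
  refine le_trans ?_ (mul_le_mul_right hG 10)
  refine le_trans ?_ (mul_le_mul_right (mul_le_mul_right (mul_le_mul_right hsm _) _) _)
  rw [Complex.volume_ball]
  have hpi' : (NNReal.pi : ℝ≥0∞) = ENNReal.ofReal Real.pi := by
    rw [ENNReal.ofReal, ← NNReal.coe_real_pi, Real.toNNReal_coe]
  have e1 : ENNReal.ofReal δ = 10 * ENNReal.ofReal (10 * δ)⁻¹ * ENNReal.ofReal δ ^ 2 := by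
    rw [show (10 : ℝ≥0∞) = ENNReal.ofReal 10 by simp, ← ENNReal.ofReal_pow hδ0.le,
      ← ENNReal.ofReal_mul (by norm_num), ← ENNReal.ofReal_mul (by positivity)]
    congr 1
    field_simp
  refine le_of_eq ?_
  rw [hpi']
  calc ‖f w‖ₑ ^ p * ENNReal.ofReal δ
      = ((ENNReal.ofReal Real.pi)⁻¹ * ENNReal.ofReal Real.pi) * (‖f w‖ₑ ^ p *
        (10 * ENNReal.ofReal (10 * δ)⁻¹ * ENNReal.ofReal δ ^ 2)) := by
        rw [ENNReal.inv_mul_cancel hpi ENNReal.ofReal_ne_top, one_mul, ← e1]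
    _ = _ := by ring

theorem enorm_rpow_mul_le_tentAreaIntegral_rpow {p s r θ φ : ℝ} {f : ℂ → ℂ} (hp : 1 ≤ p)
    (hs : 0 ≤ s) (hf : DifferentiableOn ℂ f unitDisc) (hr0 : 0 ≤ r) (hr1 : r < 1)
    (h : |φ - θ| < (1 - r) / 4) :
    ‖f (circleMap 0 r φ)‖ₑ ^ s * ENNReal.ofReal (((1 - r) / 4) ^ (s / p)) ≤
      10 ^ (s / p) * tentAreaIntegral p f θ ^ (s / p) := by
  have hsp : 0 ≤ s / p := by positivity
  have h1 := ENNReal.rpow_le_rpow (enorm_rpow_mul_le_tentAreaIntegral hp hf hr0 hr1 h) hsp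
  rwa [ENNReal.mul_rpow_of_nonneg _ _ hsp, ENNReal.mul_rpow_of_nonneg _ _ hsp, ← ENNReal.rpow_mul,
    mul_div_cancel₀ _ (by linarith : p ≠ 0),
    ENNReal.ofReal_rpow_of_nonneg (by linarith) hsp] at h1

theorem lintegral_circle_enorm_rpow_le {p s r : ℝ} {f : ℂ → ℂ} (hp : 1 ≤ p)
    (hs : 0 ≤ s) (hf : DifferentiableOn ℂ f unitDisc) (hr0 : 0 ≤ r) (hr1 : r < 1) :
    (∫⁻ θ in Set.Ioc 0 (2 * Real.pi), ‖f (circleMap 0 r θ)‖ₑ ^ s) *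
        ENNReal.ofReal (((1 - r) / 4) ^ (s / p)) ≤
      10 ^ (s / p) * ∫⁻ θ in Set.Ioc 0 (2 * Real.pi), tentAreaIntegral p f θ ^ (s / p) := by
  rw [← lintegral_mul_const' _ _ ENNReal.ofReal_ne_top, ← lintegral_const_mul' _ _
    (ENNReal.rpow_ne_top_of_nonneg (by positivity) (by simp))]
  refine lintegral_mono fun θ => enorm_rpow_mul_le_tentAreaIntegral_rpow hp hs hf hr0 hr1 ?_
  simpa using by linarith

/-- Growth estimate on the circle `|z| = r`, from averaging the pointwise bound over an arc of
length `(1 - r) / 4`. -/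
theorem enorm_rpow_circleMap_le {p s r φ : ℝ} {f : ℂ → ℂ} (hp : 1 ≤ p)
    (hs : 0 ≤ s) (hf : DifferentiableOn ℂ f unitDisc) (hr0 : 0 ≤ r) (hr1 : r < 1)
    (hφ : φ ∈ Set.Ioc 0 (2 * Real.pi)) :
    ‖f (circleMap 0 r φ)‖ₑ ^ s * ENNReal.ofReal (((1 - r) / 4) ^ (s / p)) *
        ENNReal.ofReal ((1 - r) / 4) ≤
      10 ^ (s / p) * ∫⁻ θ in Set.Ioc 0 (2 * Real.pi), tentAreaIntegral p f θ ^ (s / p) := by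
  set δ := (1 - r) / 4 with hδ
  -- A one-sided window, chosen on the side of `φ` that stays inside `(0, 2π]`.
  obtain ⟨u, hu, huφ⟩ : ∃ u, Set.Ioo u (u + δ) ⊆ Set.Ioc 0 (2 * Real.pi) ∧
      ∀ θ ∈ Set.Ioo u (u + δ), |φ - θ| < δ := by
    have hpi := Real.pi_gt_three
    rcases le_total φ Real.pi with h | h
    · refine ⟨φ, fun θ hθ => ⟨hφ.1.trans hθ.1, by linarith [hθ.2]⟩, fun θ hθ => ?_⟩
      rw [abs_lt]; constructor <;> linarith [hθ.1, hθ.2]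
    · refine ⟨φ - δ, fun θ hθ => ⟨by linarith [hθ.1], by linarith [hθ.2, hφ.2]⟩, fun θ hθ => ?_⟩
      rw [abs_lt]; constructor <;> linarith [hθ.1, hθ.2]
  rw [← lintegral_const_mul' _ _ (ENNReal.rpow_ne_top_of_nonneg (by positivity) (by simp))]
  refine le_trans ?_ (lintegral_mono_set hu)
  have hvol : volume (Set.Ioo u (u + δ)) = ENNReal.ofReal δ := by simp
  rw [← hvol, ← setLIntegral_const]
  exact setLIntegral_mono' measurableSet_Ioo fun θ hθ =>
    enorm_rpow_mul_le_tentAreaIntegral_rpow hp hs hf hr0 hr1 (huφ θ hθ)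

/-- The tent spaces over the circle, a finite measure space, decrease in the outer exponent. -/
theorem MemAnalyticTent.lintegral_lt_top {p q s : ℝ} {f : ℂ → ℂ} (hf : MemAnalyticTent p q f)
    (hp : 0 < p) (hs : 0 < s) (hsq : s ≤ q) :
    ∫⁻ θ in Set.Ioc 0 (2 * Real.pi), tentAreaIntegral p f θ ^ (s / p) < ∞ := by
  have hq : 0 < q := hs.trans_le hsq
  have hlt : ∫⁻ θ in Set.Ioc 0 (2 * Real.pi), tentAreaIntegral p f θ ^ (q / p) < ∞ := by
    have h := hf.norm_lt_top
    rw [tentNorm, ENNReal.rpow_lt_top_iff_of_pos (by positivity)] at h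
    exact h
  calc ∫⁻ θ in Set.Ioc 0 (2 * Real.pi), tentAreaIntegral p f θ ^ (s / p)
      ≤ ∫⁻ θ in Set.Ioc 0 (2 * Real.pi), (1 + tentAreaIntegral p f θ ^ (q / p)) := by
        refine lintegral_mono fun θ => ?_
        rcases le_total (tentAreaIntegral p f θ) 1 with h | h
        · exact (ENNReal.rpow_le_one h (by positivity)).trans le_self_add
        · exact (ENNReal.rpow_le_rpow_of_exponent_le h (by gcongr)).trans le_add_self
    _ = ENNReal.ofReal (2 * Real.pi) +
          ∫⁻ θ in Set.Ioc 0 (2 * Real.pi), tentAreaIntegral p f θ ^ (q / p) := by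
        rw [lintegral_add_left measurable_const]
        simp
    _ < ∞ := ENNReal.add_lt_top.2 ⟨ENNReal.ofReal_lt_top, hlt⟩

/-- Square means of `f`, by interpolating `|f|² = (|f|^s)^{(2-s)/s} |f|^s` between the growth estimate
and the means of order `s`. -/
theorem MemAnalyticTent.exists_integral_sq_le {p q s : ℝ} {f : ℂ → ℂ}
    (hf : MemAnalyticTent p q f) (hp : 1 ≤ p) (hs : 0 < s) (hsq : s ≤ q) (hs2 : s ≤ 2) :
    ∃ C : ℝ, 0 ≤ C ∧ ∀ r : ℝ, 0 ≤ r → r < 1 →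
      ∫ θ in (0 : ℝ)..2 * Real.pi, ‖f (circleMap 0 r θ)‖ ^ 2 ≤
        C * (1 - r) ^ (-(2 / p + 2 / s - 1)) := by
  have hdiff := hf.analytic.differentiableOn
  have hp0 : 0 < p := by linarith
  obtain ⟨T, hT0, hT⟩ : ∃ T : ℝ, 0 ≤ T ∧ 10 ^ (s / p) *
      ∫⁻ θ in Set.Ioc 0 (2 * Real.pi), tentAreaIntegral p f θ ^ (s / p) = ENNReal.ofReal T := by
    refine ⟨_, ENNReal.toReal_nonneg, (ENNReal.ofReal_toReal ?_).symm⟩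
    exact ENNReal.mul_ne_top (ENNReal.rpow_ne_top_of_nonneg (by positivity) (by simp))
      (hf.lintegral_lt_top hp0 hs hsq).ne
  refine ⟨T ^ ((2 - s) / s) * T * 4 ^ (2 / p + 2 / s - 1), by positivity, fun r hr0 hr1 => ?_⟩
  set δ := (1 - r) / 4 with hδ
  have hδ0 : 0 < δ := by rw [hδ]; linarith
  have hcont : Continuous fun θ => f (circleMap 0 r θ) := by
    refine hdiff.continuousOn.comp_continuous (continuous_circleMap 0 r) fun θ => ?_
    simpa [unitDisc, abs_of_nonneg hr0] using hr1
  have henorm : ∀ θ, ‖f (circleMap 0 r θ)‖ₑ ^ s = ENNReal.ofReal (‖f (circleMap 0 r θ)‖ ^ s) :=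
    fun θ => by rw [← ofReal_norm, ENNReal.ofReal_rpow_of_nonneg (norm_nonneg _) hs.le]
  have hsup : ∀ θ ∈ Set.Ioc 0 (2 * Real.pi),
      ‖f (circleMap 0 r θ)‖ ^ s ≤ T * δ ^ (-(s / p + 1)) := by
    intro θ hθ
    have h := enorm_rpow_circleMap_le hp hs.le hdiff hr0 hr1 hθ
    rw [hT, henorm, ← ENNReal.ofReal_mul (by positivity), ← ENNReal.ofReal_mul (by positivity),
      ENNReal.ofReal_le_ofReal_iff hT0] at h
    rw [Real.rpow_neg hδ0.le, Real.rpow_add hδ0, Real.rpow_one, ← div_eq_mul_inv,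
      le_div_iff₀ (by positivity), ← mul_assoc]
    exact h
  have hmean : ∫ θ in (0 : ℝ)..2 * Real.pi, ‖f (circleMap 0 r θ)‖ ^ s ≤ T * δ ^ (-(s / p)) := by
    have h := lintegral_circle_enorm_rpow_le hp hs.le hdiff hr0 hr1
    simp_rw [henorm] at h
    rw [hT, ← ofReal_integral_eq_lintegral_ofReal, ← intervalIntegral.integral_of_le (by positivity),
      ← ENNReal.ofReal_mul (intervalIntegral.integral_nonneg (by positivity)
        fun θ _ => by positivity), ENNReal.ofReal_le_ofReal_iff hT0] at h
    · rwa [Real.rpow_neg hδ0.le, ← div_eq_mul_inv, le_div_iff₀ (by positivity)]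
    · exact (hcont.norm.rpow_const fun _ => Or.inr hs.le).integrableOn_Ioc
    · exact Filter.Eventually.of_forall fun θ => by positivity
  have hpt : ∀ θ ∈ Set.Ioc 0 (2 * Real.pi), ‖f (circleMap 0 r θ)‖ ^ 2 ≤
      (T * δ ^ (-(s / p + 1))) ^ ((2 - s) / s) * ‖f (circleMap 0 r θ)‖ ^ s := by
    intro θ hθ
    have hexp : s * ((2 - s) / s) + s = 2 := by field_simp; ring
    calc ‖f (circleMap 0 r θ)‖ ^ 2
        = (‖f (circleMap 0 r θ)‖ ^ s) ^ ((2 - s) / s) * ‖f (circleMap 0 r θ)‖ ^ s := by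
          rw [← Real.rpow_mul (norm_nonneg _), ← Real.rpow_add_of_nonneg (norm_nonneg _) _ hs.le,
            hexp, Real.rpow_two]
          exact mul_nonneg hs.le (div_nonneg (by linarith) hs.le)
      _ ≤ _ := by
          exact mul_le_mul_of_nonneg_right (Real.rpow_le_rpow (by positivity) (hsup θ hθ)
            (div_nonneg (by linarith) hs.le)) (by positivity)
  calc ∫ θ in (0 : ℝ)..2 * Real.pi, ‖f (circleMap 0 r θ)‖ ^ 2
      ≤ ∫ θ in (0 : ℝ)..2 * Real.pi,
          (T * δ ^ (-(s / p + 1))) ^ ((2 - s) / s) * ‖f (circleMap 0 r θ)‖ ^ s := by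
        refine intervalIntegral.integral_mono_on_of_le_Ioo (by positivity)
          ((hcont.norm.pow 2).intervalIntegrable _ _)
          (Continuous.intervalIntegrable
            (continuous_const.mul (hcont.norm.rpow_const fun _ => Or.inr hs.le)) _ _) ?_
        exact fun θ hθ => hpt θ (Set.Ioo_subset_Ioc_self hθ)
    _ ≤ (T * δ ^ (-(s / p + 1))) ^ ((2 - s) / s) * (T * δ ^ (-(s / p))) := by
        rw [intervalIntegral.integral_const_mul]
        gcongr
    _ = T ^ ((2 - s) / s) * T * δ ^ (-(2 / p + 2 / s - 1)) := by
        rw [Real.mul_rpow hT0 (by positivity), ← Real.rpow_mul hδ0.le,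
          mul_mul_mul_comm, ← Real.rpow_add hδ0]
        congr 2
        field_simp
        ring
    _ = T ^ ((2 - s) / s) * T * 4 ^ (2 / p + 2 / s - 1) * (1 - r) ^ (-(2 / p + 2 / s - 1)) := by
        rw [hδ, Real.div_rpow (by linarith) (by norm_num), Real.rpow_neg (by norm_num : (0:ℝ) ≤ 4),
          div_inv_eq_mul]
        ring

/-! ### From square means to coefficients -/

/-- Parseval's identity for the polynomial `∑_{k<N} a_k r^k X^k` on the unit circle. -/
theorem sum_sq_eq_integral_circleMap (a : ℕ → ℂ) (r : ℝ) (hr : 0 ≤ r) (N : ℕ) :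
    ∑ k ∈ Finset.range N, (‖a k‖ * r ^ k) ^ 2 =
      (2 * Real.pi)⁻¹ * ∫ θ in (0 : ℝ)..2 * Real.pi,
        ‖∑ k ∈ Finset.range N, a k * circleMap 0 r θ ^ k‖ ^ 2 := by
  let P : Polynomial ℂ := ∑ k ∈ Finset.range N, Polynomial.monomial k (a k * (r : ℂ) ^ k)
  have hcoeff : ∀ k, P.coeff k = if k < N then a k * (r : ℂ) ^ k else 0 := fun k => by
    simp [P, Polynomial.coeff_monomial]
  have h := P.sum_sq_norm_coeff_eq_circleAverage
  rw [Finset.sum_subset (s₂ := Finset.range N)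
    (fun k hk => by
      by_contra hkN
      exact Polynomial.mem_support_iff.1 hk (by simp [hcoeff, Finset.mem_range.not.1 hkN]))
    (fun k _ hk => by simp [Polynomial.notMem_support_iff.1 hk]), Real.circleAverage_def,
    smul_eq_mul] at h
  convert h using 2
  · rename_i k hk
    rw [hcoeff, if_pos (Finset.mem_range.1 hk), norm_mul, norm_pow, Complex.norm_real,
      Real.norm_of_nonneg hr]
  · refine intervalIntegral.integral_congr fun θ _ => ?_
    simp [P, Polynomial.eval_finsetSum, Polynomial.eval_monomial, circleMap, mul_pow, mul_assoc]

theorem sum_sq_le_integral_circleMap {a : ℕ → ℂ} {f : ℂ → ℂ}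
    (ha : ∀ z ∈ unitDisc, HasSum (fun k => a k * z ^ k) (f z))
    {r : ℝ} (hr0 : 0 ≤ r) (hr1 : r < 1) (N : ℕ) :
    ∑ k ∈ Finset.range N, (‖a k‖ * r ^ k) ^ 2 ≤
      (2 * Real.pi)⁻¹ * ∫ θ in (0 : ℝ)..2 * Real.pi, ‖f (circleMap 0 r θ)‖ ^ 2 := by
  have hmem : ∀ θ, circleMap 0 r θ ∈ unitDisc := fun θ => by
    simpa [unitDisc, abs_of_nonneg hr0] using hr1
  have hs : Summable fun k => ‖a k‖ * r ^ k := by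
    have h := (ha (r : ℂ) (by simpa [unitDisc, abs_of_nonneg hr0] using hr1)).summable.norm
    simpa [abs_of_nonneg hr0] using h
  have hlim : Filter.Tendsto (fun M => (2 * Real.pi)⁻¹ * ∫ θ in (0 : ℝ)..2 * Real.pi,
      ‖∑ k ∈ Finset.range M, a k * circleMap 0 r θ ^ k‖ ^ 2) Filter.atTop
      (nhds ((2 * Real.pi)⁻¹ * ∫ θ in (0 : ℝ)..2 * Real.pi, ‖f (circleMap 0 r θ)‖ ^ 2)) := by
    refine Filter.Tendsto.const_mul _ ?_
    refine intervalIntegral.tendsto_integral_filter_of_dominated_convergence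
      (fun _ => (∑' k, ‖a k‖ * r ^ k) ^ 2)
      (Filter.Eventually.of_forall fun M => Continuous.aestronglyMeasurable (by fun_prop))
      (Filter.Eventually.of_forall fun M => Filter.Eventually.of_forall fun θ _ => ?_)
      (by simp) (Filter.Eventually.of_forall fun θ _ => ?_)
    · rw [norm_pow, norm_norm]
      gcongr
      refine (norm_sum_le _ _).trans ?_
      simp only [norm_mul, norm_pow, norm_circleMap_zero, abs_of_nonneg hr0]
      exact hs.sum_le_tsum _ fun k _ => by positivity
    · exact (ha _ (hmem θ)).tendsto_sum_nat.norm.pow 2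
  refine ge_of_tendsto hlim ((Filter.eventually_ge_atTop N).mono fun M hM => ?_)
  rw [← sum_sq_eq_integral_circleMap a r hr0 M]
  exact Finset.sum_le_sum_of_subset_of_nonneg (Finset.range_mono hM) fun _ _ _ => by positivity

theorem sum_range_two_pow_le_of_dyadic {g u : ℕ → ℝ}
    (h : ∀ j, ∑ k ∈ Finset.Ico (2 ^ j) (2 ^ (j + 1)), g k ≤ u j) (J : ℕ) :
    ∑ k ∈ Finset.range (2 ^ J), g k ≤ g 0 + ∑ j ∈ Finset.range J, u j := by
  induction J with
  | zero => simp
  | succ J ih =>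
    rw [Finset.sum_range_succ, Finset.range_eq_Ico, ← Finset.sum_Ico_consecutive g (Nat.zero_le _)
      (Nat.pow_le_pow_right two_pos J.le_succ), ← Finset.range_eq_Ico]
    linarith [h J]

/-- Bernoulli's inequality: on the circle of radius `1 - 2^{-(j+3)}` the powers below `2^{j+1}` are not
yet damped. -/
theorem half_le_dyadic_radius_pow {j k : ℕ} (hk : k < 2 ^ (j + 1)) :
    (1 : ℝ) / 2 ≤ ((1 - ((2 : ℝ) ^ (j + 3))⁻¹) ^ k) ^ 2 := by
  have hx1 : ((2 : ℝ) ^ (j + 3))⁻¹ ≤ 1 := inv_le_one_of_one_le₀ (one_le_pow₀ one_le_two)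
  have hB := one_add_mul_le_pow (a := -((2 : ℝ) ^ (j + 3))⁻¹) (by linarith) (k * 2)
  rw [← sub_eq_add_neg] at hB
  rw [← pow_mul]
  refine le_trans ?_ hB
  have hk' : (k : ℝ) ≤ 2 ^ (j + 1) := by exact_mod_cast hk.le
  have h8 : (2 : ℝ) ^ (j + 1) * ((2 : ℝ) ^ (j + 3))⁻¹ = 1 / 4 := by
    rw [pow_add, pow_add]; field_simp; norm_num
  have := mul_le_mul_of_nonneg_right hk' (by positivity : 0 ≤ ((2 : ℝ) ^ (j + 3))⁻¹)
  push_cast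
  linarith

theorem summable_norm_div_of_sum_sq_le {a : ℕ → ℂ} {C b : ℝ} (hC : 0 ≤ C) (hb : b < 1)
    (h : ∀ r : ℝ, 0 ≤ r → r < 1 → ∀ N,
      ∑ k ∈ Finset.range N, (‖a k‖ * r ^ k) ^ 2 ≤ C * (1 - r) ^ (-b)) :
    Summable fun k : ℕ => ‖a k‖ / (k + 1) := by
  set D : ℝ := 2 * C * 8 ^ b
  set η : ℝ := 2 ^ b / 2
  have hD : 0 ≤ D := by positivity
  have hη0 : 0 ≤ η := by positivity
  have hη1 : η < 1 := by
    have : (2 : ℝ) ^ b < 2 ^ (1 : ℝ) := Real.rpow_lt_rpow_of_exponent_lt one_lt_two hb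
    rw [Real.rpow_one] at this
    simp only [η]; linarith
  have hsq : ∀ j, ∑ k ∈ Finset.Ico (2 ^ j) (2 ^ (j + 1)), ‖a k‖ ^ 2 ≤ D * (2 ^ b) ^ j := by
    intro j
    have hx0 : 0 < ((2 : ℝ) ^ (j + 3))⁻¹ := by positivity
    have hx1 : ((2 : ℝ) ^ (j + 3))⁻¹ ≤ 1 := inv_le_one_of_one_le₀ (one_le_pow₀ one_le_two)
    have h1 := h (1 - ((2 : ℝ) ^ (j + 3))⁻¹) (by linarith) (by linarith) (2 ^ (j + 1))
    have h2 : (1 - (1 - ((2 : ℝ) ^ (j + 3))⁻¹)) ^ (-b) = 8 ^ b * (2 ^ b) ^ j := by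
      rw [sub_sub_cancel, Real.inv_rpow (by positivity), Real.rpow_neg (by positivity), inv_inv,
        pow_add, Real.mul_rpow (by positivity) (by positivity), ← Real.rpow_natCast 2 j,
        ← Real.rpow_mul (by norm_num), mul_comm (j : ℝ), Real.rpow_mul (by norm_num),
        Real.rpow_natCast]
      norm_num
      ring
    rw [h2] at h1
    calc ∑ k ∈ Finset.Ico (2 ^ j) (2 ^ (j + 1)), ‖a k‖ ^ 2
        ≤ ∑ k ∈ Finset.Ico (2 ^ j) (2 ^ (j + 1)),
            2 * (‖a k‖ * (1 - ((2 : ℝ) ^ (j + 3))⁻¹) ^ k) ^ 2 := by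
          refine Finset.sum_le_sum fun k hk => ?_
          have := mul_le_mul_of_nonneg_left
            (half_le_dyadic_radius_pow (Finset.mem_Ico.1 hk).2) (sq_nonneg ‖a k‖)
          rw [mul_pow]
          linarith
      _ ≤ ∑ k ∈ Finset.range (2 ^ (j + 1)),
            2 * (‖a k‖ * (1 - ((2 : ℝ) ^ (j + 3))⁻¹) ^ k) ^ 2 := by
          refine Finset.sum_le_sum_of_subset_of_nonneg (fun k hk => ?_) fun _ _ _ => by positivity
          exact Finset.mem_range.2 (Finset.mem_Ico.1 hk).2
      _ ≤ D * (2 ^ b) ^ j := by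
          rw [← Finset.mul_sum]
          simp only [D]
          linarith
  have hblock : ∀ j, ∑ k ∈ Finset.Ico (2 ^ j) (2 ^ (j + 1)), ‖a k‖ / (k + 1) ≤
      √D * √η ^ j := by
    intro j
    refine le_of_sq_le_sq ?_ (by positivity)
    have hcard : (Finset.Ico (2 ^ j) (2 ^ (j + 1))).card = 2 ^ j := by
      rw [Nat.card_Ico, pow_succ]; omega
    calc (∑ k ∈ Finset.Ico (2 ^ j) (2 ^ (j + 1)), ‖a k‖ / (k + 1)) ^ 2
        ≤ 2 ^ j * ∑ k ∈ Finset.Ico (2 ^ j) (2 ^ (j + 1)), (‖a k‖ / (k + 1)) ^ 2 := by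
          have := sq_sum_le_card_mul_sum_sq (s := Finset.Ico (2 ^ j) (2 ^ (j + 1)))
            (f := fun k : ℕ => ‖a k‖ / (k + 1))
          rw [hcard] at this
          exact_mod_cast this
      _ ≤ 2 ^ j * ∑ k ∈ Finset.Ico (2 ^ j) (2 ^ (j + 1)), ‖a k‖ ^ 2 / (2 ^ j) ^ 2 := by
          gcongr 2 ^ j * ?_
          refine Finset.sum_le_sum fun k hk => ?_
          have hk' : (2 : ℝ) ^ j ≤ k := by exact_mod_cast (Finset.mem_Ico.1 hk).1
          rw [div_pow]
          gcongr
          linarith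
      _ ≤ 2 ^ j * (D * (2 ^ b) ^ j / (2 ^ j) ^ 2) := by
          rw [← Finset.sum_div]
          gcongr
          exact hsq j
      _ = (√D * √η ^ j) ^ 2 := by
          rw [mul_pow, Real.sq_sqrt hD, pow_right_comm √η, Real.sq_sqrt hη0]
          simp only [η]
          rw [div_pow]
          field_simp
  have hη' : √η < 1 := by rw [Real.sqrt_lt' one_pos]; simpa using hη1
  have hu : Summable fun j => √D * √η ^ j :=
    (summable_geometric_of_lt_one (Real.sqrt_nonneg _) hη').mul_left _
  refine summable_of_sum_range_le (c := ‖a 0‖ / ((0 : ℕ) + 1) + ∑' j, √D * √η ^ j)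
    (fun k => by positivity) fun N => ?_
  calc ∑ k ∈ Finset.range N, ‖a k‖ / (k + 1)
      ≤ ∑ k ∈ Finset.range (2 ^ N), ‖a k‖ / (k + 1) :=
        Finset.sum_le_sum_of_subset_of_nonneg (Finset.range_mono Nat.lt_two_pow_self.le)
          fun _ _ _ => by positivity
    _ ≤ _ := (sum_range_two_pow_le_of_dyadic hblock N).trans
        (by gcongr; exact hu.sum_le_tsum _ fun _ _ => by positivity)

/-! ### Moments of Carleson measures -/

namespace IsOneCarleson

variable {μ : Measure (Set.Ico (0 : ℝ) 1)}

/-- The Carleson condition as a bound on tails, valid for all real `t > 0`: the truncation at `0`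
accounts for the empty tails `t ≥ 1`. -/
theorem exists_tail_le (hμ : IsOneCarleson μ) :
    ∃ C : ℝ, 0 ≤ C ∧ μ Set.univ ≤ ENNReal.ofReal C ∧
      ∀ t : ℝ, 0 < t → μ {x | t ≤ (x : ℝ)} ≤ ENNReal.ofReal (C * max (1 - t) 0) := by
  unfold IsOneCarleson at hμ
  set S := ⨆ t : Set.Ico (0 : ℝ) 1, μ (Set.Ici t) / ENNReal.ofReal (1 - (t : ℝ))
  have hb : ∀ t : Set.Ico (0 : ℝ) 1, μ (Set.Ici t) ≤ ENNReal.ofReal (S.toReal * (1 - (t : ℝ))) := by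
    intro t
    have h : μ (Set.Ici t) / ENNReal.ofReal (1 - (t : ℝ)) ≤ S :=
      le_iSup (fun t : Set.Ico (0 : ℝ) 1 => μ (Set.Ici t) / ENNReal.ofReal (1 - (t : ℝ))) t
    have hpos : 0 < 1 - (t : ℝ) := by linarith [t.2.2]
    rw [ENNReal.div_le_iff (by simpa using hpos) ENNReal.ofReal_ne_top] at h
    rwa [ENNReal.ofReal_mul ENNReal.toReal_nonneg, ENNReal.ofReal_toReal hμ.ne]
  refine ⟨S.toReal, ENNReal.toReal_nonneg, ?_, fun t ht => ?_⟩
  · have h0 := hb ⟨0, le_rfl, one_pos⟩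
    have : (Set.Ici (⟨0, le_rfl, one_pos⟩ : Set.Ico (0 : ℝ) 1)) = Set.univ := by
      ext x
      simpa using! x.2.1
    simpa [this] using h0
  · by_cases h1 : t < 1
    · rw [max_eq_left (by linarith)]
      exact hb ⟨t, ht.le, h1⟩
    · have : {x : Set.Ico (0 : ℝ) 1 | t ≤ (x : ℝ)} = ∅ := by
        ext x
        simpa using x.2.2.trans_le (not_lt.1 h1)
      simp [this]

theorem isFiniteMeasure (hμ : IsOneCarleson μ) : IsFiniteMeasure μ := by
  obtain ⟨C, -, hC, -⟩ := hμ.exists_tail_le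
  exact ⟨hC.trans_lt ENNReal.ofReal_lt_top⟩

/-- The layer cake formula bounds the moment by `C n ∫_0^1 (1 - t) t^{n-1} dt = C / (n + 1)`. -/
theorem exists_moment_le (hμ : IsOneCarleson μ) :
    ∃ C : ℝ, 0 ≤ C ∧ ∀ n : ℕ, moment μ n ≤ C / (n + 1) := by
  obtain ⟨C, hC0, huniv, hC⟩ := hμ.exists_tail_le
  refine ⟨C, hC0, fun n => ?_⟩
  have hnn : ∀ x : Set.Ico (0 : ℝ) 1, 0 ≤ (x : ℝ) ^ n := fun x => pow_nonneg x.2.1 n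
  rw [moment, integral_eq_lintegral_of_nonneg_ae (Filter.Eventually.of_forall hnn)
    (by fun_prop)]
  refine ENNReal.toReal_le_of_le_ofReal (by positivity) ?_
  -- The layer cake formula needs a positive exponent; the zeroth moment is the total mass.
  rcases Nat.eq_zero_or_pos n with rfl | hn
  · simpa using huniv
  have hn' : (0 : ℝ) < n := by exact_mod_cast hn
  have hlc := lintegral_rpow_eq_lintegral_meas_le_mul μ (f := fun x : Set.Ico (0 : ℝ) 1 => (x : ℝ))
    (Filter.Eventually.of_forall fun x => x.2.1) (by fun_prop) hn'
  simp only [Real.rpow_natCast] at hlc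
  rw [hlc]
  have hexp : ((n : ℝ) - 1) = ((n - 1 : ℕ) : ℝ) := by rw [Nat.cast_sub hn]; simp
  have hint : ∫ t in (0 : ℝ)..1, C * (1 - t) * t ^ (n - 1) = C / (n * (n + 1)) := by
    have : ∀ t : ℝ, C * (1 - t) * t ^ (n - 1) = C * (t ^ (n - 1) - t ^ n) := by
      intro t
      obtain ⟨m, rfl⟩ : ∃ m, n = m + 1 := ⟨n - 1, by omega⟩
      simp only [Nat.add_sub_cancel]; ring
    simp_rw [this]
    rw [intervalIntegral.integral_const_mul, intervalIntegral.integral_sub (by simp) (by simp),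
      integral_pow, integral_pow]
    have h0 : (n - 1 : ℕ) + 1 = n := by omega
    rw [← hexp, h0]
    simp [hn.ne']
    field_simp
    ring
  calc ENNReal.ofReal n * ∫⁻ t in Set.Ioi (0 : ℝ), μ {x | t ≤ (x : ℝ)} *
          ENNReal.ofReal (t ^ ((n : ℝ) - 1))
      ≤ ENNReal.ofReal n * ∫⁻ t in Set.Ioi (0 : ℝ), (Set.Ioc (0 : ℝ) 1).indicator
          (fun t => ENNReal.ofReal (C * (1 - t) * t ^ (n - 1))) t := by
        gcongr ENNReal.ofReal n * ?_
        refine setLIntegral_mono' measurableSet_Ioi fun t (ht : 0 < t) => ?_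
        rw [hexp, Real.rpow_natCast]
        refine (mul_le_mul_left (hC t ht) _).trans ?_
        by_cases h1 : t ≤ 1
        · rw [Set.indicator_of_mem (show t ∈ Set.Ioc (0 : ℝ) 1 from ⟨ht, h1⟩),
            max_eq_left (by linarith), ← ENNReal.ofReal_mul (mul_nonneg hC0 (by linarith))]
        · rw [max_eq_right (by linarith)]
          simp
    _ = ENNReal.ofReal n * ENNReal.ofReal (C / (n * (n + 1))) := by
        rw [lintegral_indicator measurableSet_Ioc, Measure.restrict_restrict measurableSet_Ioc,
          Set.inter_eq_left.2 Set.Ioc_subset_Ioi_self, ← hint,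
          intervalIntegral.integral_of_le zero_le_one, ofReal_integral_eq_lintegral_ofReal]
        · exact (Continuous.integrableOn_Ioc (by fun_prop))
        · refine (ae_restrict_iff' measurableSet_Ioc).2 (Filter.Eventually.of_forall fun t ht => ?_)
          exact mul_nonneg (mul_nonneg hC0 (by linarith [ht.2])) (pow_nonneg ht.1.le _)
    _ = ENNReal.ofReal (C / (n + 1)) := by
        rw [← ENNReal.ofReal_mul hn'.le]
        congr 1
        field_simp

end IsOneCarleson

/-! ### The Hankel operator and the integral operator -/

section Hilbert

variable {μ : Measure (Set.Ico (0 : ℝ) 1)}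

theorem integrable_pow_Ico [IsFiniteMeasure μ] (n : ℕ) :
    Integrable (fun t : Set.Ico (0 : ℝ) 1 => (t : ℝ) ^ n) μ := by
  refine Integrable.of_bound (by fun_prop) 1 (Filter.Eventually.of_forall fun t => ?_)
  rw [Real.norm_of_nonneg (pow_nonneg t.2.1 n)]
  exact pow_le_one₀ t.2.1 t.2.2.le

theorem moment_nonneg (n : ℕ) : 0 ≤ moment μ n :=
  integral_nonneg fun t => pow_nonneg t.2.1 n

theorem moment_antitone [IsFiniteMeasure μ] : Antitone (moment μ) := fun _ _ h =>
  integral_mono (integrable_pow_Ico _) (integrable_pow_Ico _)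
    fun t => pow_le_pow_of_le_one t.2.1 t.2.2.le h

theorem summable_moment_add_mul [IsFiniteMeasure μ] {a : ℕ → ℂ}
    (hs : Summable fun k => moment μ k * ‖a k‖) (n : ℕ) :
    Summable fun k => moment μ (n + k) * ‖a k‖ :=
  hs.of_nonneg_of_le (fun _ => mul_nonneg (moment_nonneg _) (norm_nonneg _))
    fun k => mul_le_mul_of_nonneg_right (moment_antitone (Nat.le_add_left k n)) (norm_nonneg _)

theorem norm_hankelCoeff_le [IsFiniteMeasure μ] {a : ℕ → ℂ}
    (hs : Summable fun k => moment μ k * ‖a k‖) (n : ℕ) :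
    ‖hankelCoeff μ a n‖ ≤ ∑' k, moment μ k * ‖a k‖ := by
  have hn : ∀ k, ‖(moment μ (n + k) : ℂ) * a k‖ = moment μ (n + k) * ‖a k‖ := fun k => by
    rw [norm_mul, Complex.norm_real, Real.norm_of_nonneg (moment_nonneg _)]
  have hs' := summable_moment_add_mul hs n
  refine (norm_tsum_le_tsum_norm (by simpa only [hn] using hs')).trans ?_
  simp_rw [hn]
  exact hs'.tsum_le_tsum (fun k => mul_le_mul_of_nonneg_right
    (moment_antitone (Nat.le_add_left k n)) (norm_nonneg _)) hs

theorem summable_hankelCoeff_mul_pow [IsFiniteMeasure μ] {a : ℕ → ℂ}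
    (hs : Summable fun k => moment μ k * ‖a k‖) {z : ℂ} (hz : z ∈ unitDisc) :
    Summable fun n => hankelCoeff μ a n * z ^ n := by
  have hz1 : ‖z‖ < 1 := by simpa [unitDisc] using hz
  refine Summable.of_norm_bounded
    ((summable_geometric_of_lt_one (norm_nonneg z) hz1).mul_left (∑' k, moment μ k * ‖a k‖))
    fun n => ?_
  rw [norm_mul, norm_pow]
  exact mul_le_mul_of_nonneg_right (norm_hankelCoeff_le hs n) (by positivity)

theorem analyticOnNhd_tsum_mul_pow {c : ℕ → ℂ}
    (hc : ∀ z ∈ unitDisc, Summable fun n => c n * z ^ n) :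
    AnalyticOnNhd ℂ (fun z => ∑' n, c n * z ^ n) unitDisc := by
  have hr : 1 ≤ (FormalMultilinearSeries.ofScalars ℂ c).radius := by
    refine ENNReal.le_of_forall_nnreal_lt fun r hr => ?_
    have hr1 : (r : ℝ) < 1 := by exact_mod_cast hr
    refine FormalMultilinearSeries.le_radius_of_tendsto (l := 0) _ ?_
    have := (hc (r : ℝ) (by simpa [unitDisc] using hr1)).tendsto_atTop_zero.norm
    simpa [FormalMultilinearSeries.ofScalars_norm] using this
  have hp := (FormalMultilinearSeries.ofScalars ℂ c).hasFPowerSeriesOnBall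
    (lt_of_lt_of_le one_pos hr)
  have hsub : unitDisc ⊆ Metric.eball 0 (FormalMultilinearSeries.ofScalars ℂ c).radius := by
    intro z hz
    have hz1 : ‖z‖ < 1 := by simpa [unitDisc] using hz
    refine Metric.mem_eball.2 (lt_of_lt_of_le ?_ hr)
    rw [edist_zero_right]
    simpa [enorm, ← NNReal.coe_lt_coe] using hz1
  refine (hp.analyticOnNhd.mono hsub).congr ?_ fun z hz => ?_
  · exact Metric.isOpen_ball
  · simp [FormalMultilinearSeries.sum, mul_comm]

/-- Termwise integration of `t^n f(t) = ∑ a_k t^{n+k}`. -/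
theorem integrable_apply_coe_of_hasSum [IsFiniteMeasure μ] {a : ℕ → ℂ} {f : ℂ → ℂ}
    (ha : ∀ z ∈ unitDisc, HasSum (fun k => a k * z ^ k) (f z))
    (hs : Summable fun k => moment μ k * ‖a k‖) :
    Integrable (fun t : Set.Ico (0 : ℝ) 1 => f ((t : ℝ) : ℂ)) μ ∧
      ∀ n, hankelCoeff μ a n = ∫ t : Set.Ico (0 : ℝ) 1, ((t : ℝ) : ℂ) ^ n * f ((t : ℝ) : ℂ) ∂μ := by
  have hint : ∀ n k, Integrable (fun t : Set.Ico (0 : ℝ) 1 => a k * ((t : ℝ) : ℂ) ^ (n + k)) μ := by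
    intro n k
    refine Integrable.const_mul ?_ _
    exact_mod_cast (integrable_pow_Ico (μ := μ) (n + k)).ofReal (𝕜 := ℂ)
  have hnorm : ∀ n k, ∫ t : Set.Ico (0 : ℝ) 1, ‖a k * ((t : ℝ) : ℂ) ^ (n + k)‖ ∂μ =
      moment μ (n + k) * ‖a k‖ := by
    intro n k
    rw [moment, mul_comm, ← integral_const_mul]
    refine integral_congr_ae (Filter.Eventually.of_forall fun t => ?_)
    simp only [norm_mul, norm_pow, Complex.norm_real, Real.norm_of_nonneg t.2.1]
  have hdisc : ∀ t : Set.Ico (0 : ℝ) 1, ((t : ℝ) : ℂ) ∈ unitDisc := fun t => by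
    simpa [unitDisc, abs_of_nonneg t.2.1] using t.2.2
  have htsum : ∀ n (t : Set.Ico (0 : ℝ) 1), ∑' k, a k * ((t : ℝ) : ℂ) ^ (n + k) =
      ((t : ℝ) : ℂ) ^ n * f ((t : ℝ) : ℂ) := by
    intro n t
    rw [← (ha _ (hdisc t)).tsum_eq, ← tsum_mul_left]
    exact tsum_congr fun k => by ring
  refine ⟨?_, fun n => ?_⟩
  · have hmeas : AEStronglyMeasurable (fun t : Set.Ico (0 : ℝ) 1 => f ((t : ℝ) : ℂ)) μ :=
      aestronglyMeasurable_of_tendsto_ae (u := Filter.atTop)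
        (f := fun N (t : Set.Ico (0 : ℝ) 1) => ∑ k ∈ Finset.range N, a k * ((t : ℝ) : ℂ) ^ k)
        (fun N => by fun_prop)
        (Filter.Eventually.of_forall fun t => (ha _ (hdisc t)).tendsto_sum_nat)
    refine ⟨hmeas, ?_⟩
    calc ∫⁻ t : Set.Ico (0 : ℝ) 1, ‖f ((t : ℝ) : ℂ)‖ₑ ∂μ
        ≤ ∫⁻ t : Set.Ico (0 : ℝ) 1, ∑' k, ‖a k * ((t : ℝ) : ℂ) ^ k‖ₑ ∂μ :=
          lintegral_mono fun t => by
            rw [← (ha _ (hdisc t)).tsum_eq]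
            exact enorm_tsum_le_tsum_enorm
      _ = ∑' k, ENNReal.ofReal (moment μ k * ‖a k‖) := by
          rw [lintegral_tsum fun k => by fun_prop]
          refine tsum_congr fun k => ?_
          have h0 := hint 0 k
          have h1 := hnorm 0 k
          simp only [zero_add] at h0 h1
          rw [← h1, ofReal_integral_norm_eq_lintegral_enorm h0]
      _ < ∞ := lt_top_iff_ne_top.2 hs.tsum_ofReal_ne_top
  · have h := hasSum_integral_of_summable_integral_norm (hint n)
      (by simpa only [hnorm] using summable_moment_add_mul hs n)
    simp only [htsum] at h
    rw [← h.tsum_eq, hankelCoeff]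
    refine tsum_congr fun k => ?_
    rw [integral_const_mul, mul_comm, moment, ← integral_complex_ofReal]
    simp

theorem generalizedHilbert_eq_integralHilbert [IsFiniteMeasure μ] {a : ℕ → ℂ} {f : ℂ → ℂ}
    (ha : ∀ z ∈ unitDisc, HasSum (fun k => a k * z ^ k) (f z))
    (hs : Summable fun k => moment μ k * ‖a k‖) {z : ℂ} (hz : z ∈ unitDisc) :
    Integrable (fun t : Set.Ico (0 : ℝ) 1 => f ((t : ℝ) : ℂ) / (1 - ((t : ℝ) : ℂ) * z)) μ ∧
      generalizedHilbert μ a z = integralHilbert μ f z := by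
  obtain ⟨hfint, hcoeff⟩ := integrable_apply_coe_of_hasSum ha hs
  have hz1 : ‖z‖ < 1 := by simpa [unitDisc] using hz
  have htz : ∀ t : Set.Ico (0 : ℝ) 1, ‖((t : ℝ) : ℂ) * z‖ ≤ ‖z‖ := fun t => by
    rw [norm_mul, Complex.norm_real, Real.norm_of_nonneg t.2.1]
    exact mul_le_of_le_one_left (norm_nonneg z) t.2.2.le
  have hlow : ∀ t : Set.Ico (0 : ℝ) 1, 1 - ‖z‖ ≤ ‖1 - ((t : ℝ) : ℂ) * z‖ := fun t => by
    have := norm_sub_norm_le (1 : ℂ) (((t : ℝ) : ℂ) * z)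
    rw [norm_one] at this
    linarith [htz t]
  have hpos : 0 < 1 - ‖z‖ := by linarith
  refine ⟨?_, ?_⟩
  · simp_rw [div_eq_mul_inv]
    refine hfint.mul_bdd (c := (1 - ‖z‖)⁻¹) (by fun_prop) (Filter.Eventually.of_forall fun t => ?_)
    rw [norm_inv]
    exact inv_anti₀ hpos (hlow t)
  have hbd : ∀ n (t : Set.Ico (0 : ℝ) 1), ‖(((t : ℝ) : ℂ) * z) ^ n‖ ≤ ‖z‖ ^ n := fun n t => by
    rw [norm_pow]
    exact pow_le_pow_left₀ (norm_nonneg _) (htz t) n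
  have hint : ∀ n, Integrable
      (fun t : Set.Ico (0 : ℝ) 1 => f ((t : ℝ) : ℂ) * (((t : ℝ) : ℂ) * z) ^ n) μ := fun n =>
    hfint.mul_bdd (c := ‖z‖ ^ n) (by fun_prop) (Filter.Eventually.of_forall (hbd n))
  have hsum : Summable fun n => ∫ t : Set.Ico (0 : ℝ) 1,
      ‖f ((t : ℝ) : ℂ) * (((t : ℝ) : ℂ) * z) ^ n‖ ∂μ := by
    refine Summable.of_nonneg_of_le (fun n => integral_nonneg fun t => norm_nonneg _) (fun n => ?_)
      ((summable_geometric_of_lt_one (norm_nonneg z) hz1).mul_left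
        (∫ t : Set.Ico (0 : ℝ) 1, ‖f ((t : ℝ) : ℂ)‖ ∂μ))
    rw [← integral_mul_const]
    refine integral_mono (hint n).norm (hfint.norm.mul_const _) fun t => ?_
    simp only [norm_mul (f _)]
    exact mul_le_mul_of_nonneg_left (hbd n t) (norm_nonneg _)
  have h := hasSum_integral_of_summable_integral_norm hint hsum
  rw [generalizedHilbert, integralHilbert]
  calc ∑' n, hankelCoeff μ a n * z ^ n
      = ∑' n, ∫ t : Set.Ico (0 : ℝ) 1, f ((t : ℝ) : ℂ) * (((t : ℝ) : ℂ) * z) ^ n ∂μ := by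
        refine tsum_congr fun n => ?_
        rw [hcoeff, ← integral_mul_const]
        exact integral_congr_ae (Filter.Eventually.of_forall fun t => by simp only [mul_pow]; ring)
    _ = ∫ t : Set.Ico (0 : ℝ) 1, f ((t : ℝ) : ℂ) / (1 - ((t : ℝ) : ℂ) * z) ∂μ := by
        rw [h.tsum_eq]
        refine integral_congr_ae (Filter.Eventually.of_forall fun t => ?_)
        simp only
        rw [tsum_mul_left, tsum_geometric_of_norm_lt_one ((htz t).trans_lt hz1), div_eq_mul_inv]

end Hilbert

/-! ### Coefficients of functions in analytic tent spaces -/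

/-- The coefficient estimate behind the proposition. -/
theorem MemAnalyticTent.summable_norm_div {p q : ℝ} (hp : 2 < p) (hq : 1 < q)
    (hpq : 1 / p + 1 / q < 1) {f : ℂ → ℂ} (hf : MemAnalyticTent p q f) {a : ℕ → ℂ}
    (ha : ∀ z ∈ unitDisc, HasSum (fun k => a k * z ^ k) (f z)) :
    Summable fun k : ℕ => ‖a k‖ / (k + 1) := by
  -- For `q ≤ 2` this is `1/p + 1/q < 1`; for `q ≥ 2` it is `p > 2`.
  have hb : 2 / p + 2 / min q 2 - 1 < 1 := by
    rcases le_total q 2 with h | h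
    · rw [min_eq_left h]
      have h1 : 2 / p + 2 / q = 2 * (1 / p + 1 / q) := by ring
      linarith
    · rw [min_eq_right h]
      have : 2 / p < 1 := (div_lt_one (by linarith)).2 hp
      linarith
  obtain ⟨C, hC0, hC⟩ := hf.exists_integral_sq_le (s := min q 2) (by linarith)
    (lt_min (by linarith) two_pos) (min_le_left _ _) (min_le_right _ _)
  refine summable_norm_div_of_sum_sq_le (C := (2 * Real.pi)⁻¹ * C) (by positivity) hb
    fun r hr0 hr1 N => ?_
  rw [mul_assoc]
  exact (sum_sq_le_integral_circleMap ha hr0 hr1 N).trans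
    (mul_le_mul_of_nonneg_left (hC r hr0 hr1) (by positivity))

theorem IsOneCarleson.summable_moment_mul {μ : Measure (Set.Ico (0 : ℝ) 1)}
    (hμ : IsOneCarleson μ) {a : ℕ → ℂ} (ha : Summable fun k : ℕ => ‖a k‖ / (k + 1)) :
    Summable fun k => moment μ k * ‖a k‖ := by
  obtain ⟨C, -, hC⟩ := hμ.exists_moment_le
  refine (ha.mul_left C).of_nonneg_of_le
    (fun k => mul_nonneg (moment_nonneg _) (norm_nonneg _)) fun k => ?_
  rw [mul_div_left_comm, mul_comm]
  exact mul_le_mul_of_nonneg_left (hC k) (norm_nonneg _)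

theorem proposition1p3 (p q : ℝ) (hp : 2 < p) (hq : 1 < q) (hpq : 1 / p + 1 / q < 1)
    (f : ℂ → ℂ) (hf : MemAnalyticTent p q f)
    (a : ℕ → ℂ) (ha : ∀ z ∈ unitDisc, HasSum (fun k => a k * z ^ k) (f z))
    (μ : MeasureTheory.Measure (Set.Ico (0 : ℝ) 1)) (hμ : IsOneCarleson μ) :
    (∀ n : ℕ, Summable (fun k => moment μ (n + k) * ‖a k‖)) ∧
    ((∀ z ∈ unitDisc, Summable (fun n => hankelCoeff μ a n * z ^ n)) ∧
      AnalyticOnNhd ℂ (generalizedHilbert μ a) unitDisc) ∧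
    (∀ z ∈ unitDisc,
      MeasureTheory.Integrable
        (fun t : Set.Ico (0 : ℝ) 1 => f ((t : ℝ) : ℂ) / (1 - ((t : ℝ) : ℂ) * z)) μ ∧
      generalizedHilbert μ a z = integralHilbert μ f z) := by
  have := hμ.isFiniteMeasure
  have hs := hμ.summable_moment_mul (hf.summable_norm_div hp hq hpq ha)
  exact ⟨summable_moment_add_mul hs,
    ⟨fun z hz => summable_hankelCoeff_mul_pow hs hz,
      analyticOnNhd_tsum_mul_pow fun z hz => summable_hankelCoeff_mul_pow hs hz⟩,
    fun z hz => generalizedHilbert_eq_integralHilbert ha hs hz⟩
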